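/- Formulas are built from propositional letters, $\top$ and $\bot$ by $\wedge$, $\vee$, $\Box$, $\Diamond$; a consequence pair is an expression $\phi\trianglelefteq\psi$ with $\phi,\psi$ formulas. The basic weak positive modal logic $\mathcal{L}$ is the smallest set of consequence pairs that is closed under uniform substitution, contains, for all formulas $\phi,\psi$, $$\phi\trianglelefteq\top,\quad \bot\trianglelefteq\phi,\quad \phi\trianglelefteq\phi,\quad \phi\wedge\psi\trianglelefteq\phi,\quad \phi\wedge\psi\trianglelefteq\psi,\quad \phi\trianglelefteq\phi\vee\psi,\quad \psi\trianglelefteq\phi\vee\psi,$$ $$\top\trianglelefteq\Box\top,\quad \top\trianglelefteq\Diamond\top,\quad \Box\phi\wedge\Box\psi\trianglelefteq\Box(\phi\wedge\psi),\quad \Diamond\phi\wedge\Box\psi\trianglelefteq\Diamond(\phi\wedge\psi),$$ and is closed under the following rules: from $\phi\trianglelefteq\psi$ and $\psi\trianglelefteq\theta$ infer $\phi\trianglelefteq\theta$; from $\phi\trianglelefteq\psi$ and $\phi\trianglelefteq\theta$ infer $\phi\trianglelefteq\psi\wedge\theta$; from $\phi\trianglelefteq\theta$ and $\psi\trianglelefteq\theta$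 infer $\phi\vee\psi\trianglelefteq\theta$; from $\phi\trianglelefteq\psi$ infer $\Box\phi\trianglelefteq\Box\psi$ and $\Diamond\phi\trianglelefteq\Diamond\psi$. Write $\phi\vdash\psi$ if $\phi\trianglelefteq\psi$ belongs to $\mathcal{L}$. **Corollary.** Weak positive modal logic has the Craig interpolation property: let $P,Q,R$ be sets of propositional letters with $Q\cap R=\emptyset$, let $\phi$ be a formula whose letters lie in $P\cup Q$ and $\psi$ a formula whose letters lie in $P\cup R$. If $\phi\vdash\psi$, then there is a formula $\chi$ whose letters all lie in $P$ such that $\phi\vdash\chi$ and $\chi\vdash\psi$. -/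

import Mathlib

namespace WeakPositiveModal

universe u

/-- Formulas of weak positive modal logic over a type `V` of propositional letters. -/
inductive Fm (V : Type u) : Type u
  | var : V → Fm V
  | top : Fm V
  | bot : Fm V
  | and : Fm V → Fm V → Fm V
  | or : Fm V → Fm V → Fm V
  | box : Fm V → Fm V
  | dia : Fm V → Fm V

namespace Fm

variable {V : Type u}

/-- Uniform substitution of formulas for propositional letters. -/
def subst (σ : V → Fm V) : Fm V → Fm V
  | var v => σ v
  | top => top
  | bot => bot
  | and φ ψ => and (subst σ φ) (subst σ ψ)
  | or φ ψ => or (subst σ φ) (subst σ ψ)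
  | box φ => box (subst σ φ)
  | dia φ => dia (subst σ φ)

/-- The set of propositional letters occurring in a formula. -/
def vars : Fm V → Set V
  | var v => {v}
  | top => ∅
  | bot => ∅
  | and φ ψ => vars φ ∪ vars ψ
  | or φ ψ => vars φ ∪ vars ψ
  | box φ => vars φ
  | dia φ => vars φ

/-- The formulas generated from the letters in `S`. -/
def inLetters (S : Set V) : Set (Fm V) := {φ | φ.vars ⊆ S}

end Fm

open Fm in
/-- `Derivable φ ψ` says that the consequence pair `φ ⊴ ψ` belongs to the basic weak positive
modal logic: the smallest set of consequence pairs that contains the axioms and is closed under the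
rules below and under uniform substitution. -/
inductive Derivable {V : Type u} : Fm V → Fm V → Prop
  | le_top (φ : Fm V) : Derivable φ top
  | bot_le (φ : Fm V) : Derivable bot φ
  | refl (φ : Fm V) : Derivable φ φ
  | trans {φ ψ θ : Fm V} : Derivable φ ψ → Derivable ψ θ → Derivable φ θ
  | and_left (φ ψ : Fm V) : Derivable (and φ ψ) φ
  | and_right (φ ψ : Fm V) : Derivable (and φ ψ) ψ
  | or_left (φ ψ : Fm V) : Derivable φ (or φ ψ)
  | or_right (φ ψ : Fm V) : Derivable ψ (or φ ψ)
  | le_and {φ ψ θ : Fm V} : Derivable φ ψ → Derivable φ θ → Derivable φ (and ψ θ)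
  | or_le {φ ψ θ : Fm V} : Derivable φ θ → Derivable ψ θ → Derivable (or φ ψ) θ
  | box_top : Derivable top (box top)
  | dia_top : Derivable top (dia top)
  | box_mono {φ ψ : Fm V} : Derivable φ ψ → Derivable (box φ) (box ψ)
  | dia_mono {φ ψ : Fm V} : Derivable φ ψ → Derivable (dia φ) (dia ψ)
  | linearity (φ ψ : Fm V) : Derivable (and (box φ) (box ψ)) (box (and φ ψ))
  | duality (φ ψ : Fm V) : Derivable (and (dia φ) (box ψ)) (dia (and φ ψ))
  | subst (σ : V → Fm V) {φ ψ : Fm V} : Derivable φ ψ → Derivable (φ.subst σ) (ψ.subst σ)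

end WeakPositiveModal

namespace WeakPositiveModal

variable {V : Type*}

namespace Derivable

open Fm

/-! Without negation every letter occurs positively, so putting `⊤` for the unwanted letters of `φ`
gives a weaker formula (`le_subst`). Those letters do not occur in `ψ`, so the same substitution,
applied to the pair `φ ⊴ ψ`, leaves `ψ` unchanged (`subst_eq_self`). The interpolant thus does not
depend on `ψ`. -/

theorem and_mono {φ φ' ψ ψ' : Fm V} (h₁ : Derivable φ φ') (h₂ : Derivable ψ ψ') :
    Derivable (and φ ψ) (and φ' ψ') :=
  le_and (trans (and_left φ ψ) h₁) (trans (and_right φ ψ) h₂)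

theorem or_mono {φ φ' ψ ψ' : Fm V} (h₁ : Derivable φ φ') (h₂ : Derivable ψ ψ') :
    Derivable (or φ ψ) (or φ' ψ') :=
  or_le (trans h₁ (or_left φ' ψ')) (trans h₂ (or_right φ' ψ'))

/-- Every connective is monotone, so an inflationary substitution weakens every formula. -/
theorem le_subst {σ : V → Fm V} (hσ : ∀ v, Derivable (var v) (σ v)) (φ : Fm V) :
    Derivable φ (φ.subst σ) := by
  induction φ with
  | var v => exact hσ v
  | top => exact refl _
  | bot => exact refl _
  | and φ ψ h₁ h₂ => exact and_mono h₁ h₂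
  | or φ ψ h₁ h₂ => exact or_mono h₁ h₂
  | box φ h => exact box_mono h
  | dia φ h => exact dia_mono h

end Derivable

namespace Fm

/-- A substitution that fixes the letters of a formula fixes the formula. -/
theorem subst_eq_self {σ : V → Fm V} {φ : Fm V} (h : ∀ v ∈ φ.vars, σ v = var v) :
    φ.subst σ = φ := by
  induction φ with
  | var v => exact h v rfl
  | top => rfl
  | bot => rfl
  | and φ ψ h₁ h₂ =>
    exact congrArg₂ and (h₁ fun v hv => h v (.inl hv)) (h₂ fun v hv => h v (.inr hv))
  | or φ ψ h₁ h₂ =>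
    exact congrArg₂ or (h₁ fun v hv => h v (.inl hv)) (h₂ fun v hv => h v (.inr hv))
  | box φ ih => exact congrArg box (ih h)
  | dia φ ih => exact congrArg dia (ih h)

theorem vars_subst_subset {σ : V → Fm V} {S : Set V} {φ : Fm V}
    (h : ∀ v ∈ φ.vars, (σ v).vars ⊆ S) : (φ.subst σ).vars ⊆ S := by
  induction φ with
  | var v => exact h v rfl
  | top => exact Set.empty_subset S
  | bot => exact Set.empty_subset S
  | and φ ψ h₁ h₂ =>
    exact Set.union_subset (h₁ fun v hv => h v (.inl hv)) (h₂ fun v hv => h v (.inr hv))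
  | or φ ψ h₁ h₂ =>
    exact Set.union_subset (h₁ fun v hv => h v (.inl hv)) (h₂ fun v hv => h v (.inr hv))
  | box φ ih => exact ih h
  | dia φ ih => exact ih h

open Classical in
/-- The substitution of `⊤` for the letters in `S`. -/
noncomputable def topOn (S : Set V) (v : V) : Fm V := if v ∈ S then top else var v

theorem topOn_of_mem {S : Set V} {v : V} (h : v ∈ S) : topOn S v = top := if_pos h

theorem topOn_of_notMem {S : Set V} {v : V} (h : v ∉ S) : topOn S v = var v := if_neg h

/-- This is where `⊤` matters: being the largest formula, it makes the substitution inflationary, as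
`le_subst` requires. -/
theorem var_le_topOn (S : Set V) (v : V) : Derivable (var v) (topOn S v) := by
  by_cases h : v ∈ S
  · rw [topOn_of_mem h]
    exact .le_top _
  · rw [topOn_of_notMem h]
    exact .refl _

end Fm

end WeakPositiveModal

open WeakPositiveModal Fm in
/-- The interpolant is `φ` with `⊤` substituted for the letters in `Q \ P`. -/
theorem mainTheorem2 {V : Type*} (P Q R : Set V) (hQR : Disjoint Q R)
    (φ ψ : WeakPositiveModal.Fm V)
    (hφ : φ ∈ WeakPositiveModal.Fm.inLetters (P ∪ Q))
    (hψ : ψ ∈ WeakPositiveModal.Fm.inLetters (P ∪ R))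
    (h : WeakPositiveModal.Derivable φ ψ) :
    ∃ χ ∈ WeakPositiveModal.Fm.inLetters P,
      WeakPositiveModal.Derivable φ χ ∧ WeakPositiveModal.Derivable χ ψ := by
  -- `P` and `Q` may overlap, and `ψ` may contain letters of `P ∩ Q`; hence `Q \ P` instead of `Q`.
  have hfix : ψ.subst (topOn (Q \ P)) = ψ := subst_eq_self fun v hv =>
    topOn_of_notMem fun hvQ =>
      (hψ hv).elim hvQ.2 fun hvR => Set.disjoint_left.mp hQR hvQ.1 hvR
  refine ⟨φ.subst (topOn (Q \ P)), vars_subst_subset fun v hv => ?_,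
    .le_subst (var_le_topOn _) φ, ?_⟩
  · by_cases hP : v ∈ P
    · rw [topOn_of_notMem fun hvQ => hvQ.2 hP]
      exact Set.singleton_subset_iff.mpr hP
    · rw [topOn_of_mem (S := Q \ P) ⟨(hφ hv).resolve_left hP, hP⟩]
      exact Set.empty_subset P
  -- Closure of the logic under uniform substitution gives the second half.
  · have := Derivable.subst (topOn (Q \ P)) h
    rwa [hfix] at this
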